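/- Let $\mathbb P^2$ be the complex projective plane and let $Gr(2,\mathbb C^4)$ be the Grassmannian of two-dimensional quotient spaces of $\mathbb C^4$, regarded as a projective variety by means of the Plücker embedding $Gr(2,\mathbb C^4)\hookrightarrow\mathbb P^5$; let $\mathcal O_{Gr(2,\mathbb C^4)}(1)$ be the restriction of $\mathcal O_{\mathbb P^5}(1)$. For every integer $n\ge 1$ there is a morphism of complex varieties $$f_n:\mathbb P^2\to Gr(2,\mathbb C^4)$$ which is injective (one-to-one onto its image) and satisfies $f_n^*\mathcal O_{Gr(2,\mathbb C^4)}(1)\cong\mathcal O_{\mathbb P^2}(n)$. Moreover, $f_n$ can be chosen to be the morphism $x\mapsto(\mathbb C^4\to E_x)$ given by a surjection of vector bundles $\mathbb C^4\otimes\mathcal O_{\mathbb P^2}\to E=\mathcal O_{\mathbb P^2}(1)\oplus\mathcal O_{\mathbb P^2}(n-1)$. -/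

import Mathlib

open TopologicalSpace
open scoped LinearAlgebra.Projectivization

noncomputable section

/-! ## Complex varieties as spaces with functions -/

/-- A space with functions over `ℂ`: a topological space together with a sheaf of `ℂ`-algebras of
`ℂ`-valued functions, the regular functions. Classical complex varieties (sets of closed points
with the Zariski topology) are spaces with functions. -/
structure SpaceWithFunctions where
  space : TopCat.{0}
  /-- The regular functions on the open subsets. -/
  regular : TopCat.LocalPredicate (fun _ : space => ℂ)
  const_regular : ∀ (U : Opens space) (c : ℂ), regular.pred (U := U) fun _ => c
  add_regular : ∀ {U : Opens space} {g h : U → ℂ},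
    regular.pred g → regular.pred h → regular.pred fun x => g x + h x
  mul_regular : ∀ {U : Opens space} {g h : U → ℂ},
    regular.pred g → regular.pred h → regular.pred fun x => g x * h x

namespace SpaceWithFunctions

/-- A morphism: a continuous map that pulls regular functions on open sets back to regular
functions. -/
structure Hom (X Y : SpaceWithFunctions) where
  map : C(X.space, Y.space)
  comp_regular : ∀ (U : Opens Y.space) (g : U → ℂ), Y.regular.pred g →
    X.regular.pred (U := U.comap map) fun x => g ⟨map x.1, x.2⟩

/-- An algebraic line bundle on `X`: a one-dimensional vector space over each point, together with
a sheaf of regular sections which is locally freely generated over the regular functions by one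
section that is a basis of every fibre. -/
structure LineBundle (X : SpaceWithFunctions) where
  Fiber : X.space → Type
  [addCommGroup : ∀ x, AddCommGroup (Fiber x)]
  [module : ∀ x, Module ℂ (Fiber x)]
  /-- The regular sections on the open subsets. -/
  regularSection : TopCat.LocalPredicate Fiber
  locally_trivial : ∀ x : X.space, ∃ (U : Opens X.space) (_ : x ∈ U) (e : ∀ y : U, Fiber y),
    (∀ (y : U) (v : Fiber y), ∃! c : ℂ, v = c • e y) ∧
    ∀ (V : Opens X.space) (h : V ≤ U) (s : ∀ y : V, Fiber y),
      regularSection.pred s ↔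
        ∃ g : V → ℂ, X.regular.pred g ∧ ∀ y : V, s y = g y • e ⟨y.1, h y.2⟩

attribute [instance] LineBundle.addCommGroup LineBundle.module

/-- An isomorphism of line bundles: linear isomorphisms of the fibres that identify the
regular sections. -/
structure LineBundle.Iso {X : SpaceWithFunctions} (L M : LineBundle X) where
  toEquiv : ∀ x, L.Fiber x ≃ₗ[ℂ] M.Fiber x
  regular_iff : ∀ (U : Opens X.space) (s : ∀ x : U, L.Fiber x),
    L.regularSection.pred s ↔ M.regularSection.pred fun x : U => toEquiv x.1 (s x)

/-- The global regular sections of a line bundle. -/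
def LineBundle.GlobalSection {X : SpaceWithFunctions} (L : LineBundle X) : Type :=
  {s : ∀ x, L.Fiber x // L.regularSection.pred (U := ⊤) fun x => s x.1}

/-- The sections of `f^* L` that are of the form `g • f^* t`, with `t` a regular section of `L`
and `g` a regular function. -/
def pullbackSection {X Y : SpaceWithFunctions} (f : Hom X Y) (L : LineBundle Y) :
    TopCat.PrelocalPredicate (fun x : X.space => L.Fiber (f.map x)) where
  pred {U} s := ∃ (V : Opens Y.space) (h : U ≤ V.comap f.map) (t : ∀ y : V, L.Fiber y)
    (g : U → ℂ), L.regularSection.pred t ∧ X.regular.pred g ∧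
      ∀ x : U, s x = g x • t ⟨f.map x.1, h x.2⟩
  res := by
    rintro U V i s ⟨W, h, t, g, ht, hg, hs⟩
    exact ⟨W, fun x hx => h (i.le hx), t, fun x => g (i x), ht, X.regular.res i g hg,
      fun x => hs (i x)⟩

/-- The pullback `f^* L` of a line bundle along a morphism. -/
def LineBundle.pullback {X Y : SpaceWithFunctions} (f : Hom X Y) (L : LineBundle Y) :
    LineBundle X where
  Fiber x := L.Fiber (f.map x)
  regularSection := (pullbackSection f L).sheafify
  locally_trivial := by
    intro x
    obtain ⟨U, hxU, e, he, hs⟩ := L.locally_trivial (f.map x)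
    have key : ∀ (V : Opens Y.space) (h : V ≤ U), L.regularSection.pred
        fun y : V => e ⟨y.1, h y.2⟩ := fun V h => (hs V h _).2
      ⟨fun _ => 1, Y.const_regular V 1, fun y => (one_smul ℂ _).symm⟩
    refine ⟨U.comap f.map, hxU, fun y => e ⟨f.map y.1, y.2⟩,
      fun y v => he ⟨f.map y.1, y.2⟩ v, fun V h s => ⟨fun H => ?_, ?_⟩⟩
    · choose g hg _ using fun y : V => he ⟨f.map y.1, h y.2⟩ (s y)
      refine ⟨g, X.regular.locality g fun y => ?_, hg⟩
      obtain ⟨W, hyW, i, W', hW, t, k, ht, hk, hst⟩ := H y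
      obtain ⟨l, hl, hlt⟩ := (hs (W' ⊓ U) inf_le_right
        (fun y => t ⟨y.1, y.2.1⟩)).1 (L.regularSection.res (CategoryTheory.homOfLE inf_le_left) t ht)
      have hl' := f.comp_regular _ l hl
      have hWle : W ≤ (W' ⊓ U).comap f.map := fun z hz => ⟨hW hz, h (i.le hz)⟩
      refine ⟨W, hyW, i, ?_⟩
      have := X.mul_regular hk (X.regular.res (CategoryTheory.homOfLE hWle) _ hl')
      convert this using 1
      funext z
      refine (he ⟨f.map z.1, h (i.le z.2)⟩ (s (i z))).unique (hg (i z)) ?_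
      refine (hst z).trans ?_
      have h2 := hlt ⟨f.map z.1, hWle z.2⟩
      simp only at h2
      rw [h2, smul_smul]
      rfl
    · rintro ⟨g, hg, hgs⟩
      exact TopCat.PrelocalPredicate.sheafifyOf
        ⟨U, h, e, g, key U le_rfl, hg, hgs⟩

/-- Given a map `c` from a set `α` to a space with functions, the induced structure on `α`: the
induced topology, and the functions that are locally restrictions of regular functions. If `c` is
injective, this is the structure of the subset `c(α)`. -/
def induced {α : Type} (Y : SpaceWithFunctions) (c : α → Y.space) : SpaceWithFunctions where
  space := @TopCat.of α (TopologicalSpace.induced c inferInstance)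
  regular := TopCat.PrelocalPredicate.sheafify
    { pred := fun {U} g => ∃ (V : Opens Y.space) (h : ∀ x : U, c x.1 ∈ V) (k : V → ℂ),
        Y.regular.pred k ∧ ∀ x : U, g x = k ⟨c x.1, h x⟩
      res := by
        rintro U V i g ⟨W, h, k, hk, hg⟩
        exact ⟨W, fun x => h ⟨x.1, i.le x.2⟩, k, hk, fun x => hg ⟨x.1, i.le x.2⟩⟩ }
  const_regular U a := TopCat.PrelocalPredicate.sheafifyOf
    ⟨⊤, fun _ => trivial, fun _ => a, Y.const_regular _ a, fun _ => rfl⟩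
  add_regular := by
    intro U g h hg hh
    refine TopCat.PrelocalPredicate.sheafify_inductionOn₂' _ _ _ (fun a b : ℂ => a + b) ?_ hg hh
    rintro U V a b ⟨W, hW, k, hk, ha⟩ ⟨W', hW', k', hk', hb⟩
    exact ⟨W ⊓ W', fun x => ⟨hW ⟨x.1, x.2.1⟩, hW' ⟨x.1, x.2.2⟩⟩, _,
      Y.add_regular (Y.regular.res (CategoryTheory.homOfLE inf_le_left) k hk)
        (Y.regular.res (CategoryTheory.homOfLE inf_le_right) k' hk'),
      fun x => congrArg₂ (· + ·) (ha ⟨x.1, x.2.1⟩) (hb ⟨x.1, x.2.2⟩)⟩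
  mul_regular := by
    intro U g h hg hh
    refine TopCat.PrelocalPredicate.sheafify_inductionOn₂' _ _ _ (fun a b : ℂ => a * b) ?_ hg hh
    rintro U V a b ⟨W, hW, k, hk, ha⟩ ⟨W', hW', k', hk', hb⟩
    exact ⟨W ⊓ W', fun x => ⟨hW ⟨x.1, x.2.1⟩, hW' ⟨x.1, x.2.2⟩⟩, _,
      Y.mul_regular (Y.regular.res (CategoryTheory.homOfLE inf_le_left) k hk)
        (Y.regular.res (CategoryTheory.homOfLE inf_le_right) k' hk'),
      fun x => congrArg₂ (· * ·) (ha ⟨x.1, x.2.1⟩) (hb ⟨x.1, x.2.2⟩)⟩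

/-- The map `c` as a morphism from the induced structure. -/
def inducedHom {α : Type} (Y : SpaceWithFunctions) (c : α → Y.space) : Hom (Y.induced c) Y where
  map := @ContinuousMap.mk α Y.space (TopologicalSpace.induced c inferInstance) _ c
    continuous_induced_dom
  comp_regular U g hg := TopCat.PrelocalPredicate.sheafifyOf
    ⟨U, fun x => x.2, g, hg, fun _ => rfl⟩

end SpaceWithFunctions

/-! ## Projective space and its line bundles `O(d)` -/

namespace ProjectiveVariety

open SpaceWithFunctions

variable (ι : Type)

/-- The Zariski topology on the projective space of `ℂ^ι`: the sets `F ≠ 0`, for `F` a homogeneous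
polynomial, form a basis. -/
abbrev zariski : TopologicalSpace (ℙ ℂ (ι → ℂ)) :=
  TopologicalSpace.generateFrom
    {U | ∃ (F : MvPolynomial ι ℂ) (d : ℕ), F.IsHomogeneous d ∧
      U = {x | MvPolynomial.eval x.rep F ≠ 0}}

/-- The fibre of `O(d)` at `x`, the `d`-th tensor power of the dual of the line `x ⊆ ℂ^ι`:
the functions on this line that are homogeneous of degree `d`. -/
def twistFiber (d : ℕ) (x : ℙ ℂ (ι → ℂ)) : Submodule ℂ (x.submodule → ℂ) where
  carrier := {φ | ∀ (t : ℂ) (v : x.submodule), φ (t • v) = t ^ d * φ v}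
  add_mem' := by
    intro φ ψ hφ hψ t v
    simp only [Pi.add_apply, hφ t v, hψ t v, mul_add]
  zero_mem' := by
    intro t v
    simp
  smul_mem' := by
    intro c φ hφ t v
    simp only [Pi.smul_apply, smul_eq_mul, hφ t v]
    ring

/-- A fraction `P / Q` of homogeneous polynomials with `deg P = deg Q + d` and `Q` without zeros
on `U`, as a section of `O(d)` on `U`. -/
def fractionSection (d : ℕ) :
    TopCat.PrelocalPredicate (X := @TopCat.of (ℙ ℂ (ι → ℂ)) (zariski ι))
      (fun x => twistFiber ι d x) where
  pred {U} s := ∃ (b : ℕ) (P Q : MvPolynomial ι ℂ),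
    P.IsHomogeneous (b + d) ∧ Q.IsHomogeneous b ∧
      ∀ (x : U) (v : Projectivization.submodule x.1), v ≠ 0 →
        MvPolynomial.eval v.1 Q ≠ 0 ∧
          (s x).1 v = MvPolynomial.eval v.1 P / MvPolynomial.eval v.1 Q
  res := by
    rintro U V i s ⟨b, P, Q, hP, hQ, h⟩
    exact ⟨b, P, Q, hP, hQ, fun x => h ⟨x.1, i.le x.2⟩⟩

/-- A fraction `P / Q` of homogeneous polynomials of the same degree, with `Q` without zeros on
`U`, as a function on `U`. -/
def fractionFunction :
    TopCat.PrelocalPredicate (X := @TopCat.of (ℙ ℂ (ι → ℂ)) (zariski ι)) (fun _ => ℂ) where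
  pred {U} g := ∃ (b : ℕ) (P Q : MvPolynomial ι ℂ),
    P.IsHomogeneous b ∧ Q.IsHomogeneous b ∧
      ∀ (x : U) (v : Projectivization.submodule x.1), v ≠ 0 →
        MvPolynomial.eval v.1 Q ≠ 0 ∧
          g x = MvPolynomial.eval v.1 P / MvPolynomial.eval v.1 Q
  res := by
    rintro U V i s ⟨b, P, Q, hP, hQ, h⟩
    exact ⟨b, P, Q, hP, hQ, fun x => h ⟨x.1, i.le x.2⟩⟩

/-- The projective space of lines in `ℂ^ι`, as a space with functions: the regular functions are
locally fractions of homogeneous polynomials of the same degree. -/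
def projectiveSpace : SpaceWithFunctions where
  space := @TopCat.of (ℙ ℂ (ι → ℂ)) (zariski ι)
  regular := (fractionFunction ι).sheafify
  const_regular U c := TopCat.PrelocalPredicate.sheafifyOf
    ⟨0, MvPolynomial.C c, 1, MvPolynomial.isHomogeneous_C _ _,
      MvPolynomial.isHomogeneous_one _ _, fun x v _ => by simp⟩
  add_regular := by
    intro U g h hg hh
    refine TopCat.PrelocalPredicate.sheafify_inductionOn₂' _ _ _ (fun a b : ℂ => a + b) ?_ hg hh
    rintro U V a b ⟨m, P, Q, hP, hQ, ha⟩ ⟨n, R, S, hR, hS, hb⟩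
    refine ⟨m + n, P * S + Q * R, Q * S, (hP.mul hS).add (hQ.mul hR), hQ.mul hS, fun x v hv => ?_⟩
    obtain ⟨h1, h2⟩ := ha ⟨x.1, x.2.1⟩ v hv
    obtain ⟨h3, h4⟩ := hb ⟨x.1, x.2.2⟩ v hv
    simp only [map_add, map_mul, h2, h4]
    exact ⟨mul_ne_zero h1 h3, div_add_div _ _ h1 h3⟩
  mul_regular := by
    intro U g h hg hh
    refine TopCat.PrelocalPredicate.sheafify_inductionOn₂' _ _ _ (fun a b : ℂ => a * b) ?_ hg hh
    rintro U V a b ⟨m, P, Q, hP, hQ, ha⟩ ⟨n, R, S, hR, hS, hb⟩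
    refine ⟨m + n, P * R, Q * S, hP.mul hR, hQ.mul hS, fun x v hv => ?_⟩
    obtain ⟨h1, h2⟩ := ha ⟨x.1, x.2.1⟩ v hv
    obtain ⟨h3, h4⟩ := hb ⟨x.1, x.2.2⟩ v hv
    simp only [map_mul, h2, h4]
    exact ⟨mul_ne_zero h1 h3, div_mul_div_comm _ _ _ _⟩

variable {ι}

theorem eval_smul_of_isHomogeneous {F : MvPolynomial ι ℂ} {d : ℕ} (hF : F.IsHomogeneous d)
    (a : ℂ) (v : ι → ℂ) :
    MvPolynomial.eval (a • v) F = a ^ d * MvPolynomial.eval v F := by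
  simp only [MvPolynomial.eval_eq, Finset.mul_sum]
  refine Finset.sum_congr rfl fun m hm => ?_
  have hd : ∑ i ∈ m.support, m i = d := by
    have := hF (MvPolynomial.mem_support_iff.1 hm)
    simpa [Finsupp.weight_apply, Finsupp.sum] using this
  simp only [Pi.smul_apply, smul_eq_mul, mul_pow, Finset.prod_mul_distrib,
    Finset.prod_pow_eq_pow_sum, hd]
  ring

theorem exists_eq_smul_rep (x : ℙ ℂ (ι → ℂ)) (v : x.submodule) : ∃ a : ℂ, v.1 = a • x.rep := by
  obtain ⟨v, h⟩ := v
  rw [Projectivization.submodule_eq, Submodule.mem_span_singleton] at h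
  obtain ⟨a, ha⟩ := h
  exact ⟨a, ha.symm⟩

theorem rep_mem_submodule (x : ℙ ℂ (ι → ℂ)) : x.rep ∈ x.submodule := by
  rw [Projectivization.submodule_eq]
  exact Submodule.mem_span_singleton_self _

/-- The section `X i ^ d` of `O(d)`. -/
def coordSection (d : ℕ) (i : ι) (x : ℙ ℂ (ι → ℂ)) : twistFiber ι d x :=
  ⟨fun v => v.1 i ^ d, fun t v => by simp [mul_pow]⟩

theorem coord_ne_zero {i : ι} {x : ℙ ℂ (ι → ℂ)} (hx : x.rep i ≠ 0) {v : x.submodule}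
    (hv : v ≠ 0) : v.1 i ≠ 0 := by
  obtain ⟨a, ha⟩ := exists_eq_smul_rep x v
  have : a ≠ 0 := by
    rintro rfl
    exact hv (Subtype.ext (by simpa using ha))
  rw [ha]
  simpa using ⟨this, hx⟩

theorem existsUnique_smul_coordSection (d : ℕ) {i : ι} {x : ℙ ℂ (ι → ℂ)} (hx : x.rep i ≠ 0)
    (φ : twistFiber ι d x) : ∃! c : ℂ, φ = c • coordSection d i x := by
  refine ⟨φ.1 ⟨x.rep, rep_mem_submodule x⟩ / x.rep i ^ d, ?_, ?_⟩
  · refine Subtype.ext (funext fun v => ?_)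
    obtain ⟨a, ha⟩ := exists_eq_smul_rep x v
    have hv : v = a • (⟨x.rep, rep_mem_submodule x⟩ : x.submodule) := Subtype.ext ha
    rw [hv, φ.2 a _]
    simp only [coordSection, Submodule.coe_smul, Pi.smul_apply, smul_eq_mul, mul_pow]
    field_simp
  · rintro c rfl
    simp only [coordSection, Submodule.coe_smul, Pi.smul_apply, smul_eq_mul]
    field_simp

variable (ι)

/-- The line bundle `O(d)` on projective space: the regular sections are locally fractions `P / Q`
of homogeneous polynomials with `deg P = deg Q + d`. -/
def twist (d : ℕ) : LineBundle (projectiveSpace ι) where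
  Fiber (x : ℙ ℂ (ι → ℂ)) := twistFiber ι d x
  addCommGroup (x : ℙ ℂ (ι → ℂ)) := inferInstanceAs (AddCommGroup (twistFiber ι d x))
  module (x : ℙ ℂ (ι → ℂ)) := inferInstanceAs (Module ℂ (twistFiber ι d x))
  regularSection := (fractionSection ι d).sheafify
  locally_trivial := by
    intro (x : ℙ ℂ (ι → ℂ))
    obtain ⟨i, hi⟩ : ∃ i, x.rep i ≠ 0 := Function.ne_iff.1 x.rep_nonzero
    let U : Opens (projectiveSpace ι).space :=
      ⟨{y | Projectivization.rep (K := ℂ) (V := ι → ℂ) y i ≠ 0},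
        TopologicalSpace.isOpen_generateFrom_of_mem
          ⟨MvPolynomial.X i, 1, MvPolynomial.isHomogeneous_X _ _, by simp; rfl⟩⟩
    refine ⟨U, hi, fun y => coordSection d i y.1,
      fun y => existsUnique_smul_coordSection d y.2, fun V hV s => ⟨fun hs => ?_, ?_⟩⟩
    · choose g hg _ using fun y : V => existsUnique_smul_coordSection d (hV y.2) (s y)
      refine ⟨g, fun y => ?_, hg⟩
      obtain ⟨W, hyW, j, b, P, Q, hP, hQ, h⟩ := hs y
      refine ⟨W, hyW, j, b + d, P, Q * MvPolynomial.X i ^ d, hP,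
        hQ.mul (by simpa using (MvPolynomial.isHomogeneous_X ℂ i).pow d), fun z v hv => ?_⟩
      obtain ⟨h1, h2⟩ := h z v hv
      have h3 : v.1 i ≠ 0 := coord_ne_zero (hV (j.le z.2)) hv
      have h4 : (s ⟨z.1, j.le z.2⟩).1 v = g ⟨z.1, j.le z.2⟩ * v.1 i ^ d := by
        conv_lhs => rw [hg ⟨z.1, j.le z.2⟩]
        rfl
      have h5 : (s ⟨z.1, j.le z.2⟩).1 v = _ := h2
      rw [h4] at h5
      refine ⟨by simpa using ⟨h1, fun h => absurd h h3⟩, ?_⟩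
      simp only [map_mul, map_pow, MvPolynomial.eval_X]
      rw [← div_div, ← h5]
      field_simp
      rfl
    · rintro ⟨g, hg, hgs⟩ y
      obtain ⟨W, hyW, j, b, P, Q, hP, hQ, h⟩ := hg y
      refine ⟨W, hyW, j, b, P * MvPolynomial.X i ^ d, Q,
        hP.mul (by simpa using (MvPolynomial.isHomogeneous_X ℂ i).pow d), hQ, fun z v hv => ?_⟩
      obtain ⟨h1, h2⟩ := h z v hv
      refine ⟨h1, ?_⟩
      have h4 : (s ⟨z.1, j.le z.2⟩).1 v = g ⟨z.1, j.le z.2⟩ * v.1 i ^ d := by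
        rw [hgs ⟨z.1, j.le z.2⟩]
        rfl
      have h5 : g ⟨z.1, j.le z.2⟩ = _ := h2
      refine h4.trans ?_
      rw [h5]
      simp only [map_mul, map_pow, MvPolynomial.eval_X]
      ring

end ProjectiveVariety

/-! ## The Grassmannian of two-dimensional quotients of `ℂ⁴` -/

namespace GrassmannianVariety

open SpaceWithFunctions ProjectiveVariety Module

/-- The set `Gr(2, ℂ⁴)` of two-dimensional quotients of `ℂ⁴`; a point is the kernel of the
quotient map. -/
abbrev Gr : Type := Grassmannian ℂ (Fin 4 → ℂ) 2

theorem finrank_quotient (K : Gr) : finrank ℂ ((Fin 4 → ℂ) ⧸ K.toSubmodule) = 2 := by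
  have := K.rankAtStalk_eq ⊥
  rwa [rankAtStalk_eq_finrank_of_free] at this

/-- The indices `i < j` of the Plücker coordinates. -/
abbrev PluckerIndex : Type := {p : Fin 4 × Fin 4 // p.1 < p.2}

/-- The Plücker coordinates `e i ∧ e j ∈ ⋀² (ℂ⁴ / K) ≅ ℂ` of the quotient `ℂ⁴ / K`, computed in
some basis of `ℂ⁴ / K`. Another basis multiplies them all by the same nonzero factor. -/
def pluckerVector (K : Gr) (p : PluckerIndex) : ℂ :=
  (finBasisOfFinrankEq ℂ _ (finrank_quotient K)).det
    ![K.toSubmodule.mkQ (Pi.single p.1.1 1), K.toSubmodule.mkQ (Pi.single p.1.2 1)]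

theorem pluckerVector_ne_zero (K : Gr) : pluckerVector K ≠ 0 := by
  intro h
  set b := finBasisOfFinrankEq ℂ _ (finrank_quotient K)
  have h0 : b.det.compLinearMap K.toSubmodule.mkQ = 0 := by
    refine Basis.ext_alternating (Pi.basisFun ℂ (Fin 4)) fun v hv => ?_
    have hne : v 0 ≠ v 1 := fun h => absurd (hv h) (by decide)
    have hvec : ∀ w : Fin 2 → (Fin 4 → ℂ), b.det.compLinearMap K.toSubmodule.mkQ w =
        b.det ![K.toSubmodule.mkQ (w 0), K.toSubmodule.mkQ (w 1)] := by
      intro w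
      rw [AlternatingMap.compLinearMap_apply]
      congr 1
      funext i
      fin_cases i <;> rfl
    rcases lt_or_gt_of_ne hne with hlt | hlt
    · have := congrFun h ⟨(v 0, v 1), hlt⟩
      rw [hvec]
      simpa [pluckerVector] using this
    · have := congrFun h ⟨(v 1, v 0), hlt⟩
      have hsw := (b.det.compLinearMap K.toSubmodule.mkQ).map_swap
        (fun i => Pi.basisFun ℂ (Fin 4) (v i)) (show (0 : Fin 2) ≠ 1 by decide)
      refine neg_eq_zero.1 (hsw.symm.trans ?_)
      rw [hvec]
      simpa [pluckerVector] using this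
  choose w hw using K.toSubmodule.mkQ_surjective
  have h1 := DFunLike.congr_fun h0 (fun i => w (b i))
  simp only [AlternatingMap.compLinearMap_apply, hw, AlternatingMap.zero_apply] at h1
  have h2 : b.det b = 0 := h1
  rw [b.det_self] at h2
  exact one_ne_zero h2

/-- The Plücker embedding `Gr(2, ℂ⁴) → ℙ⁵`. -/
def plucker (K : Gr) : ℙ ℂ (PluckerIndex → ℂ) :=
  Projectivization.mk ℂ (pluckerVector K) (pluckerVector_ne_zero K)

/-- `Gr(2, ℂ⁴)` as a projective variety, by means of the Plücker embedding. -/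
def grassmannian : SpaceWithFunctions :=
  (projectiveSpace PluckerIndex).induced plucker

/-- `O(1)` on `Gr(2, ℂ⁴)`: the pullback of `O(1)` along the Plücker embedding. -/
def grassmannianTwist : LineBundle grassmannian :=
  (twist PluckerIndex 1).pullback (inducedHom (projectiveSpace PluckerIndex) plucker)

end GrassmannianVariety

/-! ## The map to the Grassmannian given by generating sections -/

namespace SpaceWithFunctions

/-- The map `ℂ⁴ → L_x ⊕ M_x` on the fibres at `x` of the homomorphism `ℂ⁴ ⊗ O → L ⊕ M` that is
given by four global sections `(s i, t i)` of `L ⊕ M`. -/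
def evalMap {X : SpaceWithFunctions} (L M : LineBundle X) (s : Fin 4 → L.GlobalSection)
    (t : Fin 4 → M.GlobalSection) (x : X.space) : (Fin 4 → ℂ) →ₗ[ℂ] L.Fiber x × M.Fiber x :=
  Fintype.linearCombination ℂ fun i => ((s i).1 x, (t i).1 x)

end SpaceWithFunctions

/-- The projective plane. -/
abbrev projectivePlane : SpaceWithFunctions := ProjectiveVariety.projectiveSpace (Fin 3)

end

/-! ### Pullbacks of line bundles and morphisms into induced spaces -/

namespace SpaceWithFunctions

open CategoryTheory

/-! Put `m = n - 1` and take the four sections `(x, y^m)`, `(y, 0)`, `(z, x^m)`, `(0, z^m)` of `O(1)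
⊕ O(m)`. Up to sign, their `2 × 2` minors are `y^(m+1)`, `x^(m+1) - z y^m`, `y x^m` and `z^m` times
each of `x, y, z`. They have no common zero, so the sections generate, and they separate points:
where `z^m ≠ 0` the last three are proportional to the point itself; on `z = 0` the second and third
are `x^m (x, y)`, which recovers the point unless `x = 0`, and then it is `(0 : 1 : 0)`. See
`minor_planeSections_ne_zero` and `exists_smul_eq_of_minor_planeSections`.

By `plucker_grassmannianMap`, the kernel map followed by the Plücker embedding is the polynomial map
given by the minors, which have degree `1 + m = n`. Hence the kernel map is a morphism, and `O(1)`
pulls back to `O(n)`. The latter is checked on fibres: composing a linear function on a line with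
polynomials of degree `n` gives a function of degree `n`, and this preserves regular sections. The
reverse implication on sections comes from local generators (`isoOfPullback`). -/

theorem LineBundle.smul_regularSection {X : SpaceWithFunctions} (L : LineBundle X)
    {U : Opens X.space} {g : U → ℂ} {s : ∀ x : U, L.Fiber x} (hg : X.regular.pred g)
    (hs : L.regularSection.pred s) : L.regularSection.pred fun x => g x • s x := by
  refine L.regularSection.locality _ fun x => ?_
  obtain ⟨W, hxW, e, -, hW⟩ := L.locally_trivial x.1
  refine ⟨U ⊓ W, ⟨x.2, hxW⟩, homOfLE inf_le_left, ?_⟩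
  obtain ⟨k, hk, hks⟩ := (hW (U ⊓ W) inf_le_right _).1
    (L.regularSection.res (homOfLE inf_le_left) s hs)
  refine (hW (U ⊓ W) inf_le_right _).2 ⟨_, X.mul_regular
    (X.regular.res (homOfLE inf_le_left) g hg) hk, fun y => ?_⟩
  have h := hks y
  simp only at h ⊢
  rw [h, smul_smul]

/-- The identification of the fibres at equal points. -/
def LineBundle.fiberCast {X : SpaceWithFunctions} (L : LineBundle X) {x y : X.space}
    (h : x = y) : L.Fiber x ≃ₗ[ℂ] L.Fiber y :=
  h ▸ LinearEquiv.refl ℂ (L.Fiber x)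

/-- Fibres at points that are only propositionally equal are different types; this lets a section be
evaluated across such an equality. -/
theorem LineBundle.fiberCast_apply {X : SpaceWithFunctions} (L : LineBundle X) {x y : X.space}
    (h : x = y) {V : Opens X.space} (t : ∀ z : V, L.Fiber z) (hx : x ∈ V) :
    L.fiberCast h (t ⟨x, hx⟩) = t ⟨y, h ▸ hx⟩ := by
  subst h
  rfl

/-- A family of linear isomorphisms `L_{f(x)} ≅ N_x` that takes the pullbacks of regular sections
of `L` to regular sections of `N` is an isomorphism `f^* L ≅ N`, provided that the inverses of
nowhere vanishing regular functions are regular. -/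
def LineBundle.isoOfPullback {X Y : SpaceWithFunctions} (f : Hom X Y) (L : LineBundle Y)
    (N : LineBundle X)
    (hinv : ∀ (U : Opens X.space) (g : U → ℂ), X.regular.pred g → (∀ x, g x ≠ 0) →
      X.regular.pred fun x => (g x)⁻¹)
    (e : ∀ x, L.Fiber (f.map x) ≃ₗ[ℂ] N.Fiber x)
    (he : ∀ (V : Opens Y.space) (t : ∀ y : V, L.Fiber y), L.regularSection.pred t →
      N.regularSection.pred (U := V.comap f.map) fun x => e x.1 (t ⟨f.map x.1, x.2⟩)) :
    LineBundle.Iso (L.pullback f) N where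
  toEquiv := e
  regular_iff U s := by
    constructor
    · intro hs
      refine N.regularSection.locality _ fun x => ?_
      obtain ⟨W, hxW, i, V, hV, t, g, ht, hg, hst⟩ := hs x
      refine ⟨W, hxW, i, ?_⟩
      convert N.smul_regularSection hg (N.regularSection.res (homOfLE hV) _ (he V t ht)) using 1
      funext z
      exact (congrArg (e z.1) (hst z)).trans (map_smul (e z.1) _ _)
    · intro hs x
      obtain ⟨V, hxV, l, hl, hV⟩ := L.locally_trivial (f.map x.1)
      obtain ⟨W, hxW, m, hm, hW⟩ := N.locally_trivial x.1
      have hlreg : L.regularSection.pred l := (hV V le_rfl l).2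
        ⟨fun _ => 1, Y.const_regular V 1, fun y => (one_smul ℂ _).symm⟩
      let A : Opens X.space := U ⊓ (V.comap f.map ⊓ W)
      obtain ⟨k, hk, hks⟩ := (hW A (inf_le_right.trans inf_le_right) _).1
        (N.regularSection.res (homOfLE inf_le_left) _ hs)
      obtain ⟨h, hh, hhl⟩ := (hW A (inf_le_right.trans inf_le_right) _).1
        (N.regularSection.res (homOfLE (inf_le_right.trans inf_le_left)) _ (he V l hlreg))
      -- A zero of `h` would be a zero of the generator `l`, against uniqueness of coefficients. So
      -- `f^* l` also generates `N`, and `s` is `k / h` times it.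
      have hne : ∀ y, h y ≠ 0 := by
        intro y hy
        have h1 := hhl y
        rw [hy, zero_smul] at h1
        have h2 : l ⟨f.map y.1, y.2.2.1⟩ = 0 := (e y.1).map_eq_zero_iff.1 h1
        have h3 : 0 = (1 : ℂ) • l ⟨f.map y.1, y.2.2.1⟩ := by rw [h2, smul_zero]
        exact one_ne_zero ((hl ⟨f.map y.1, y.2.2.1⟩ 0).unique h3 (zero_smul ℂ _).symm)
      refine ⟨A, ⟨x.2, hxV, hxW⟩, homOfLE inf_le_left, V, inf_le_right.trans inf_le_left, l,
        _, hlreg, X.mul_regular hk (hinv _ _ hh hne), fun y => (e y.1).injective ?_⟩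
      refine (hks y).trans ?_
      refine Eq.trans ?_ (map_smul (e y.1) _ _).symm
      refine Eq.trans ?_ (congrArg _ (hhl y)).symm
      rw [smul_smul, mul_assoc, inv_mul_cancel₀ (hne y), mul_one]

/-- For `g = c ∘ f`, a family of linear isomorphisms `L_{g(x)} ≅ N_x` that takes pullbacks of
regular sections of `L` along `g` to regular sections also does so for sections of `c^* L`. -/
theorem LineBundle.regularSection_of_pullback {X Y Z : SpaceWithFunctions} (f : Hom X Y)
    (c : Hom Y Z) (L : LineBundle Z) (N : LineBundle X)
    (e : ∀ x, L.Fiber (c.map (f.map x)) ≃ₗ[ℂ] N.Fiber x)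
    (he : ∀ (V : Opens Z.space) (t : ∀ y : V, L.Fiber y), L.regularSection.pred t →
      N.regularSection.pred (U := (V.comap c.map).comap f.map)
        fun x => e x.1 (t ⟨c.map (f.map x.1), x.2⟩))
    (V : Opens Y.space) (t : ∀ y : V, (L.pullback c).Fiber y)
    (ht : (L.pullback c).regularSection.pred t) :
    N.regularSection.pred (U := V.comap f.map) fun x => e x.1 (t ⟨f.map x.1, x.2⟩) := by
  refine N.regularSection.locality _ fun x => ?_
  -- Locally `t = g • c^* u`, so its pullback is `g ∘ f` times the pullback of `u` along the
  -- composite.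
  obtain ⟨W, hxW, i, A, hA, u, g, hu, hg, hst⟩ := ht ⟨f.map x.1, x.2⟩
  refine ⟨W.comap f.map, hxW, homOfLE fun y hy => i.le hy, ?_⟩
  have hle : W.comap f.map ≤ (A.comap c.map).comap f.map := fun y hy => hA hy
  convert N.smul_regularSection (f.comp_regular _ g hg)
    (N.regularSection.res (homOfLE hle) _ (he A u hu)) using 1
  funext z
  exact (congrArg (e z.1) (hst ⟨f.map z.1, z.2⟩)).trans (map_smul (e z.1) _ _)

/-- A map to an induced space is continuous if its composition with the inducing map is a
morphism. -/
def continuousMapLiftInduced {α : Type} {X Y : SpaceWithFunctions} {c : α → Y.space}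
    (g : Hom X Y) (f : X.space → α) (hf : ∀ x, c (f x) = g.map x) :
    C(X.space, (Y.induced c).space) :=
  @ContinuousMap.mk X.space α _ (TopologicalSpace.induced c inferInstance) f
    (continuous_induced_rng.2 (by
      rw [show c ∘ f = g.map from funext hf]
      exact g.map.continuous))

/-- A map to an induced space is a morphism if its composition with the inducing map is one. -/
def Hom.liftInduced {α : Type} {X Y : SpaceWithFunctions} {c : α → Y.space} (g : Hom X Y)
    (f : X.space → α) (hf : ∀ x, c (f x) = g.map x) : Hom X (Y.induced c) where
  map := continuousMapLiftInduced g f hf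
  comp_regular U k hk := by
    refine X.regular.locality _ fun x => ?_
    -- Locally `k = l ∘ c`, hence `k ∘ f = l ∘ g`.
    obtain ⟨W, hxW, i, V, hV, l, hl, hlk⟩ := hk ⟨f x.1, x.2⟩
    refine ⟨W.comap (continuousMapLiftInduced g f hf),
      hxW, homOfLE fun y hy => i.le hy, ?_⟩
    have hle : ∀ y, f y ∈ W → g.map y ∈ V := fun y hy => hf y ▸ hV ⟨f y, hy⟩
    convert X.regular.res (homOfLE (show W.comap (continuousMapLiftInduced g f hf) ≤ V.comap g.map from hle)) _ (g.comp_regular V l hl) using 1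
    funext z
    refine (hlk ⟨f z.1, z.2⟩).trans (congrArg l (Subtype.ext (hf z.1)))

end SpaceWithFunctions

/-! ### Polynomial morphisms of projective spaces and the pullback of `O(1)` -/

namespace ProjectiveVariety

open SpaceWithFunctions CategoryTheory

variable {ι κ : Type}

/-- Locally the inverse of `P / Q` is `Q / P`, and `P` has no zeros because `g` has none. -/
theorem inv_regular (U : Opens (projectiveSpace ι).space) (g : U → ℂ)
    (hg : (projectiveSpace ι).regular.pred g) (hne : ∀ x, g x ≠ 0) :
    (projectiveSpace ι).regular.pred fun x => (g x)⁻¹ := by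
  intro x
  obtain ⟨W, hxW, i, b, P, Q, hP, hQ, h⟩ := hg x
  refine ⟨W, hxW, i, b, Q, P, hQ, hP, fun z v hv => ?_⟩
  obtain ⟨h1, h2⟩ := h z v hv
  have h3 := hne ⟨z.1, i.le z.2⟩
  refine ⟨fun h0 => h3 (h2.trans (by rw [h0, zero_div])), ?_⟩
  exact (congrArg _ h2).trans (inv_div _ _)

/-- A homogeneous polynomial as a section of `O(d)`. -/
noncomputable def homogeneousSection {d : ℕ} {F : MvPolynomial ι ℂ} (hF : F.IsHomogeneous d) :
    (twist ι d).GlobalSection :=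
  ⟨fun x => (⟨fun v => MvPolynomial.eval v.1 F,
      fun t v => eval_smul_of_isHomogeneous hF t v.1⟩ : twistFiber ι d x),
    TopCat.PrelocalPredicate.sheafifyOf ⟨0, F, 1, by rwa [zero_add],
      MvPolynomial.isHomogeneous_one _ _, fun x v _ => by simp⟩⟩

/-- The chosen representative is a unit multiple of `v`, which changes the value only by a nonzero
power. -/
theorem eval_rep_ne_zero_iff {F : MvPolynomial ι ℂ} {d : ℕ} (hF : F.IsHomogeneous d)
    {v : ι → ℂ} (hv : v ≠ 0) :
    MvPolynomial.eval (Projectivization.mk ℂ v hv).rep F ≠ 0 ↔ MvPolynomial.eval v F ≠ 0 := by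
  obtain ⟨a, ha⟩ := Projectivization.exists_smul_eq_mk_rep ℂ v hv
  rw [← ha, show a • v = (a : ℂ) • v from rfl, eval_smul_of_isHomogeneous hF]
  simp

/-- The value at `x.rep`, as an isomorphism of the fibre of `O(d)` with `ℂ`. -/
noncomputable def twistFiberEquiv (d : ℕ) (x : ℙ ℂ (ι → ℂ)) {w : ι → ℂ} (hw : w ≠ 0)
    (hwx : w ∈ x.submodule) : twistFiber ι d x ≃ₗ[ℂ] ℂ :=
  LinearEquiv.ofBijective
    { toFun := fun φ => φ.1 ⟨w, hwx⟩
      map_add' := fun _ _ => rfl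
      map_smul' := fun _ _ => rfl } (by
    -- The power `X i ^ d` spans the fibre and does not vanish at `w`.
    obtain ⟨i, hi⟩ : ∃ i, x.rep i ≠ 0 := Function.ne_iff.1 x.rep_nonzero
    have hwi : w i ≠ 0 := coord_ne_zero (v := ⟨w, hwx⟩) hi fun h => hw (congrArg Subtype.val h)
    constructor
    · refine (injective_iff_map_eq_zero _).2 fun φ hφ => ?_
      obtain ⟨c, rfl, -⟩ := existsUnique_smul_coordSection d hi φ
      have : c * w i ^ d = 0 := hφ
      rw [(mul_eq_zero.1 this).resolve_right (pow_ne_zero _ hwi), zero_smul]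
    · intro c
      exact ⟨(c / w i ^ d) • coordSection d i x, div_mul_cancel₀ _ (pow_ne_zero _ hwi)⟩)

section Morphism

variable (M : κ → MvPolynomial ι ℂ) {n : ℕ} (hM : ∀ k, (M k).IsHomogeneous n)
  (hne : ∀ v : ι → ℂ, v ≠ 0 → (fun k => MvPolynomial.eval v (M k)) ≠ 0)

theorem eval_bind₁ (v : ι → ℂ) (F : MvPolynomial κ ℂ) :
    MvPolynomial.eval v (MvPolynomial.bind₁ M F) =
      MvPolynomial.eval (fun k => MvPolynomial.eval v (M k)) F := by
  simp only [MvPolynomial.eval, MvPolynomial.eval₂Hom_bind₁]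

include hM in
theorem isHomogeneous_bind₁ {F : MvPolynomial κ ℂ} {d : ℕ} (hF : F.IsHomogeneous d) :
    (MvPolynomial.bind₁ M F).IsHomogeneous (n * d) :=
  hF.aeval M hM

/-- The map of projective spaces given by homogeneous polynomials of the same degree. -/
noncomputable def polynomialMap (x : ℙ ℂ (ι → ℂ)) : ℙ ℂ (κ → ℂ) :=
  Projectivization.mk ℂ (fun k => MvPolynomial.eval x.rep (M k)) (hne _ x.rep_nonzero)

include hM in
theorem eval_mem_submodule (x : ℙ ℂ (ι → ℂ)) (v : x.submodule) :
    (fun k => MvPolynomial.eval v.1 (M k)) ∈ (polynomialMap M hne x).submodule := by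
  obtain ⟨a, ha⟩ := exists_eq_smul_rep x v
  refine Submodule.mem_span_singleton.2 ⟨a ^ n, funext fun k => ?_⟩
  rw [ha, eval_smul_of_isHomogeneous (hM k)]
  rfl

/-- The map of projective spaces given by homogeneous polynomials of the same degree, as a
continuous map. -/
noncomputable def polynomialContinuousMap : C((projectiveSpace ι).space, (projectiveSpace κ).space) :=
  @ContinuousMap.mk _ _ (zariski ι) (zariski κ) (polynomialMap M hne) (by
    let := zariski ι
    refine continuous_generateFrom_iff.2 ?_
    rintro _ ⟨F, d, hF, rfl⟩
    refine TopologicalSpace.isOpen_generateFrom_of_mem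
      ⟨MvPolynomial.bind₁ M F, n * d, isHomogeneous_bind₁ M hM hF, ?_⟩
    ext x
    simp only [Set.mem_preimage, Set.mem_ofPred_eq, polynomialMap, eval_rep_ne_zero_iff hF,
      eval_bind₁])

/-- The morphism of projective spaces given by homogeneous polynomials of the same degree without
common zeros. -/
noncomputable def polynomialHom : Hom (projectiveSpace ι) (projectiveSpace κ) where
  map := polynomialContinuousMap M hM hne
  comp_regular U g hg x := by
    obtain ⟨W, hxW, i, b, P, Q, hP, hQ, h⟩ := hg ⟨polynomialMap M hne x.1, x.2⟩
    refine ⟨W.comap (polynomialContinuousMap M hM hne), hxW,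
      homOfLE fun y hy => i.le hy, n * b, MvPolynomial.bind₁ M P,
      MvPolynomial.bind₁ M Q, isHomogeneous_bind₁ M hM hP, isHomogeneous_bind₁ M hM hQ,
      fun z v hv => ?_⟩
    rw [eval_bind₁, eval_bind₁]
    exact h ⟨polynomialMap M hne z.1, z.2⟩ ⟨_, eval_mem_submodule M hM hne z.1 v⟩
      fun h0 => hne v.1 (fun h => hv (Subtype.ext h)) (congrArg Subtype.val h0)

/-- Pulling back functions on lines along the homogeneous polynomials `M k` of degree `n`, as an
isomorphism of the fibres of the pullback of `O(1)` and of `O(n)`. -/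
noncomputable def twistPullbackFiber (x : ℙ ℂ (ι → ℂ)) :
    twistFiber κ 1 (polynomialMap M hne x) ≃ₗ[ℂ] twistFiber ι n x :=
  (twistFiberEquiv 1 _ (hne _ x.rep_nonzero)
      (eval_mem_submodule M hM hne x ⟨x.rep, rep_mem_submodule x⟩)).trans
    (twistFiberEquiv n x x.rep_nonzero (rep_mem_submodule x)).symm

/-- The isomorphism was fixed by values at `x.rep` alone. Both sides are homogeneous of degree `n`
in `v`, so agreement there spreads to the whole line. -/
theorem twistPullbackFiber_apply (x : ℙ ℂ (ι → ℂ))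
    (φ : twistFiber κ 1 (polynomialMap M hne x)) (v : x.submodule) :
    (twistPullbackFiber M hM hne x φ).1 v = φ.1 ⟨_, eval_mem_submodule M hM hne x v⟩ := by
  obtain ⟨a, ha⟩ := exists_eq_smul_rep x v
  have h1 : v = a • (⟨x.rep, rep_mem_submodule x⟩ : x.submodule) := Subtype.ext ha
  have h2 : (⟨_, eval_mem_submodule M hM hne x v⟩ : (polynomialMap M hne x).submodule) =
      a ^ n • ⟨_, eval_mem_submodule M hM hne x ⟨x.rep, rep_mem_submodule x⟩⟩ := by
    refine Subtype.ext (funext fun k => ?_)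
    simp only [ha]
    exact eval_smul_of_isHomogeneous (hM k) _ _
  rw [h2, φ.2, h1, (twistPullbackFiber M hM hne x φ).2, pow_one]
  exact congrArg _ ((twistFiberEquiv n x x.rep_nonzero (rep_mem_submodule x)).apply_symm_apply _)

/-- Substituting `M` into `P / Q` multiplies both degrees by `n`, so the difference of degrees goes
from `1` to `n`. -/
theorem twistPullbackFiber_regular (V : Opens (projectiveSpace κ).space)
    (t : ∀ y : V, (twist κ 1).Fiber y) (ht : (twist κ 1).regularSection.pred t) :
    (twist ι n).regularSection.pred (U := V.comap (polynomialHom M hM hne).map)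
      fun x => twistPullbackFiber M hM hne x.1 (t ⟨polynomialMap M hne x.1, x.2⟩) := by
  intro x
  obtain ⟨W, hxW, i, b, P, Q, hP, hQ, h⟩ := ht ⟨polynomialMap M hne x.1, x.2⟩
  refine ⟨W.comap (polynomialHom M hM hne).map, hxW, homOfLE fun y hy => i.le hy, n * b,
    MvPolynomial.bind₁ M P, MvPolynomial.bind₁ M Q, ?_, isHomogeneous_bind₁ M hM hQ,
    fun z v hv => ?_⟩
  · simpa [mul_add] using isHomogeneous_bind₁ M hM hP
  · rw [eval_bind₁, eval_bind₁]
    obtain ⟨h1, h2⟩ := h ⟨polynomialMap M hne z.1, z.2⟩ ⟨_, eval_mem_submodule M hM hne z.1 v⟩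
      fun h0 => hne v.1 (fun h => hv (Subtype.ext h)) (congrArg Subtype.val h0)
    exact ⟨h1, (twistPullbackFiber_apply M hM hne z.1 _ v).trans h2⟩

end Morphism

end ProjectiveVariety

/-! ### Maps to the Grassmannian given by sections of `O(a) ⊕ O(b)` -/

namespace GrassmannianVariety

open SpaceWithFunctions ProjectiveVariety Module

/-- The kernel of a surjection `ℂ⁴ → ℂ²` as a point of `Gr(2, ℂ⁴)`. -/
def grOfSurjective (φ : (Fin 4 → ℂ) →ₗ[ℂ] (Fin 2 → ℂ)) (hφ : Function.Surjective φ) : Gr where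
  toSubmodule := LinearMap.ker φ
  finite_quotient := inferInstance
  projective_quotient := inferInstance
  rankAtStalk_eq p := by
    rw [rankAtStalk_eq_finrank_of_free, Pi.natCast_apply,
      (φ.quotKerEquivOfSurjective hφ).finrank_eq]
    simp

/-- In the basis of the quotient induced by `φ`, the Plücker coordinates are the minors of `φ`; `a`
is the determinant of the change to the arbitrary basis in `pluckerVector`. -/
theorem exists_pluckerVector_eq (φ : (Fin 4 → ℂ) →ₗ[ℂ] (Fin 2 → ℂ))
    (hφ : Function.Surjective φ) : ∃ a : ℂ, ∀ p : PluckerIndex,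
      pluckerVector (grOfSurjective φ hφ) p =
        a * (φ (Pi.single p.1.1 1) 0 * φ (Pi.single p.1.2 1) 1 -
          φ (Pi.single p.1.2 1) 0 * φ (Pi.single p.1.1 1) 1) := by
  set K := grOfSurjective φ hφ
  set b := finBasisOfFinrankEq ℂ _ (finrank_quotient K)
  let b' : Basis (Fin 2) ℂ ((Fin 4 → ℂ) ⧸ K.toSubmodule) :=
    Basis.ofEquivFun (φ.quotKerEquivOfSurjective hφ)
  have hb' : ∀ w i, b'.repr (K.toSubmodule.mkQ w) i = φ w i := fun w i => rfl
  refine ⟨b.det b', fun p => ?_⟩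
  have h := DFunLike.congr_fun (b.det.eq_smul_basis_det b')
    ![K.toSubmodule.mkQ (Pi.single p.1.1 1), K.toSubmodule.mkQ (Pi.single p.1.2 1)]
  refine h.trans ?_
  rw [AlternatingMap.smul_apply, smul_eq_mul, b'.det_apply, Matrix.det_fin_two]
  simp only [Basis.toMatrix_apply, Matrix.cons_val_zero, Matrix.cons_val_one, hb']

/-- Cramer's rule for the images of `v` and `w`. -/
theorem surjective_of_minor_ne_zero (φ : (Fin 4 → ℂ) →ₗ[ℂ] (Fin 2 → ℂ)) (v w : Fin 4 → ℂ)
    (h : φ v 0 * φ w 1 - φ w 0 * φ v 1 ≠ 0) : Function.Surjective φ := by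
  intro y
  set d := φ v 0 * φ w 1 - φ w 0 * φ v 1 with hd
  refine ⟨((y 0 * φ w 1 - y 1 * φ w 0) / d) • v + ((y 1 * φ v 0 - y 0 * φ v 1) / d) • w,
    funext fun i => ?_⟩
  simp only [map_add, map_smul, Pi.add_apply, Pi.smul_apply, smul_eq_mul, div_mul_eq_mul_div,
    ← add_div]
  rw [div_eq_iff h, hd]
  fin_cases i
  · simp only [Fin.zero_eta]
    ring
  · simp only [Fin.mk_one]
    ring

/-- The `2 × 2` minors of four sections `(l i, q i)` of `O(1) ⊕ O(m)`. -/
noncomputable def minor {ι : Type} (l q : Fin 4 → MvPolynomial ι ℂ) (p : PluckerIndex) :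
    MvPolynomial ι ℂ :=
  l p.1.1 * q p.1.2 - l p.1.2 * q p.1.1

theorem isHomogeneous_minor {ι : Type} {l q : Fin 4 → MvPolynomial ι ℂ} {a b : ℕ}
    (hl : ∀ i, (l i).IsHomogeneous a) (hq : ∀ i, (q i).IsHomogeneous b) (p : PluckerIndex) :
    (minor l q p).IsHomogeneous (a + b) :=
  ((hl _).mul (hq _)).sub ((hl _).mul (hq _))

/-- The value at `v` of the homomorphism `ℂ⁴ ⊗ O → O(a) ⊕ O(b)` given by `(l i, q i)`. -/
noncomputable def evalPair {ι : Type} (l q : Fin 4 → MvPolynomial ι ℂ) (v : ι → ℂ) :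
    (Fin 4 → ℂ) →ₗ[ℂ] (Fin 2 → ℂ) :=
  Fintype.linearCombination ℂ fun i => ![MvPolynomial.eval v (l i), MvPolynomial.eval v (q i)]

theorem evalPair_minor {ι : Type} (l q : Fin 4 → MvPolynomial ι ℂ) (v : ι → ℂ)
    (p : PluckerIndex) :
    evalPair l q v (Pi.single p.1.1 1) 0 * evalPair l q v (Pi.single p.1.2 1) 1 -
      evalPair l q v (Pi.single p.1.2 1) 0 * evalPair l q v (Pi.single p.1.1 1) 1 =
    MvPolynomial.eval v (minor l q p) := by
  simp [evalPair, minor, Fintype.linearCombination_apply_single]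

section

variable {ι : Type} (l q : Fin 4 → MvPolynomial ι ℂ)
  (hne : ∀ v : ι → ℂ, v ≠ 0 → (fun p => MvPolynomial.eval v (minor l q p)) ≠ 0)

include hne in
theorem evalPair_surjective {v : ι → ℂ} (hv : v ≠ 0) : Function.Surjective (evalPair l q v) := by
  obtain ⟨p, hp⟩ := Function.ne_iff.1 (hne v hv)
  exact surjective_of_minor_ne_zero _ _ _ ((evalPair_minor l q v p).trans_ne hp)

/-- The map to the Grassmannian given by four sections that generate `O(a) ⊕ O(b)`. -/
noncomputable def grassmannianMap (x : ℙ ℂ (ι → ℂ)) : Gr :=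
  grOfSurjective (evalPair l q x.rep) (evalPair_surjective l q hne x.rep_nonzero)

theorem plucker_grassmannianMap (x : ℙ ℂ (ι → ℂ)) :
    plucker (grassmannianMap l q hne x) = polynomialMap (minor l q) hne x := by
  obtain ⟨a, ha⟩ := exists_pluckerVector_eq (evalPair l q x.rep)
    (evalPair_surjective l q hne x.rep_nonzero)
  refine (Projectivization.mk_eq_mk_iff' ℂ _ _ _ _).2 ⟨a, funext fun p => ?_⟩
  refine Eq.trans ?_ (ha p).symm
  rw [evalPair_minor]
  rfl

variable {a b : ℕ} (hl : ∀ i, (l i).IsHomogeneous a) (hq : ∀ i, (q i).IsHomogeneous b)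

/-- The morphism to the Grassmannian given by four sections that generate `O(a) ⊕ O(b)`. -/
noncomputable def grassmannianHom : Hom (projectiveSpace ι) grassmannian :=
  Hom.liftInduced (polynomialHom (minor l q) (isHomogeneous_minor hl hq) hne)
    (grassmannianMap l q hne) (plucker_grassmannianMap l q hne)

/-- The isomorphisms of the fibres of the pullback of the Plücker line bundle with those of
`O(a + b)`. -/
noncomputable def grassmannianTwistFiber (x : (projectiveSpace ι).space) :
    (twist PluckerIndex 1).Fiber ((inducedHom (projectiveSpace PluckerIndex) plucker).map
      ((grassmannianHom l q hne hl hq).map x)) ≃ₗ[ℂ] (twist ι (a + b)).Fiber x :=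
  LinearEquiv.trans
    (M₂ := (twist PluckerIndex 1).Fiber
      ((polynomialHom (minor l q) (isHomogeneous_minor hl hq) hne).map x))
    ((twist PluckerIndex 1).fiberCast (plucker_grassmannianMap l q hne x))
    (twistPullbackFiber (minor l q) (isHomogeneous_minor hl hq) hne x)

theorem grassmannianTwistFiber_regular (V : Opens (projectiveSpace PluckerIndex).space)
    (t : ∀ y : V, (twist PluckerIndex 1).Fiber y)
    (ht : (twist PluckerIndex 1).regularSection.pred t) :
    (twist ι (a + b)).regularSection.pred
      (U := (V.comap (inducedHom (projectiveSpace PluckerIndex) plucker).map).comap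
        (grassmannianHom l q hne hl hq).map)
      fun x => grassmannianTwistFiber l q hne hl hq x.1 (t ⟨_, x.2⟩) := by
  have hle : (V.comap (inducedHom (projectiveSpace PluckerIndex) plucker).map).comap
      (grassmannianHom l q hne hl hq).map ≤
      V.comap (polynomialHom (minor l q) (isHomogeneous_minor hl hq) hne).map := by
    intro x hx
    have h : polynomialMap (minor l q) hne x ∈ V := plucker_grassmannianMap l q hne x ▸ hx
    exact h
  refine (congrArg (twist ι (a + b)).regularSection.pred (funext fun x => ?_)).mpr
    ((twist ι (a + b)).regularSection.res (CategoryTheory.homOfLE hle) _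
      (twistPullbackFiber_regular (minor l q) (isHomogeneous_minor hl hq) hne V t ht))
  exact congrArg (twistPullbackFiber (minor l q) (isHomogeneous_minor hl hq) hne x.1)
    ((twist PluckerIndex 1).fiberCast_apply (plucker_grassmannianMap l q hne x.1) t x.2)

/-- The pullback of the Plücker line bundle along the morphism given by four sections that
generate `O(a) ⊕ O(b)` is `O(a + b)`. -/
noncomputable def grassmannianTwistPullbackIso :
    LineBundle.Iso (grassmannianTwist.pullback (grassmannianHom l q hne hl hq))
      (twist ι (a + b)) :=
  LineBundle.isoOfPullback _ grassmannianTwist _ inv_regular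
    (grassmannianTwistFiber l q hne hl hq)
    (LineBundle.regularSection_of_pullback _ _ _ _ _
      (grassmannianTwistFiber_regular l q hne hl hq))

/-- Equal kernels have equal Plücker points; injectivity of the Plücker embedding is not needed. -/
theorem exists_minor_eq_of_grassmannianMap_eq {x y : ℙ ℂ (ι → ℂ)}
    (h : grassmannianMap l q hne x = grassmannianMap l q hne y) :
    ∃ c : ℂ, ∀ p, c * MvPolynomial.eval y.rep (minor l q p) =
      MvPolynomial.eval x.rep (minor l q p) := by
  have h1 := congrArg plucker h
  rw [plucker_grassmannianMap, plucker_grassmannianMap] at h1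
  obtain ⟨c, hc⟩ := (Projectivization.mk_eq_mk_iff' ℂ _ _ _ _).1 h1
  exact ⟨c, congrFun hc⟩

/-- The trivialization of the fibre of `O(a) ⊕ O(b)` at `x` given by `x.rep`. -/
noncomputable def twistPairEquiv (a b : ℕ) (x : (projectiveSpace ι).space) :
    ((twist ι a).Fiber x × (twist ι b).Fiber x) ≃ₗ[ℂ] (Fin 2 → ℂ) :=
  (LinearEquiv.prodCongr
    (twistFiberEquiv a x (Projectivization.rep_nonzero x) (rep_mem_submodule x) :
      (twist ι a).Fiber x ≃ₗ[ℂ] ℂ)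
    (twistFiberEquiv b x (Projectivization.rep_nonzero x) (rep_mem_submodule x) :
      (twist ι b).Fiber x ≃ₗ[ℂ] ℂ)).trans (LinearEquiv.finTwoArrow ℂ ℂ).symm

/-- Transfers surjectivity and the kernel from the matrix at `x.rep` to the bundle map on the fibre.
-/
theorem evalPair_eq_evalMap (x : (projectiveSpace ι).space) :
    evalPair l q (Projectivization.rep (K := ℂ) (V := ι → ℂ) x) =
      (twistPairEquiv a b x).toLinearMap ∘ₗ
        evalMap (twist ι a) (twist ι b) (fun i => homogeneousSection (hl i))
          (fun i => homogeneousSection (hq i)) x := by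
  refine (Pi.basisFun ℂ (Fin 4)).ext fun i => ?_
  simp only [evalPair, evalMap, Pi.basisFun_apply, LinearMap.comp_apply,
    Fintype.linearCombination_apply_single, one_smul, LinearEquiv.coe_coe]
  funext j
  fin_cases j <;> rfl

include hne in
theorem evalMap_surjective (x : (projectiveSpace ι).space) :
    Function.Surjective (evalMap (twist ι a) (twist ι b) (fun i => homogeneousSection (hl i))
      (fun i => homogeneousSection (hq i)) x) := by
  have h := evalPair_surjective l q hne (Projectivization.rep_nonzero (K := ℂ) (V := ι → ℂ) x)
  rw [evalPair_eq_evalMap l q hl hq] at h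
  exact ((twistPairEquiv a b x).comp_surjective _).1 h

theorem toSubmodule_grassmannianMap (x : (projectiveSpace ι).space) :
    (grassmannianMap l q hne x).toSubmodule = LinearMap.ker (evalMap (twist ι a) (twist ι b)
      (fun i => homogeneousSection (hl i)) (fun i => homogeneousSection (hq i)) x) :=
  (congrArg LinearMap.ker (evalPair_eq_evalMap l q hl hq x)).trans
    (LinearEquiv.ker_comp (twistPairEquiv a b x) _)

end

/-! ### The explicit sections on the plane -/

section PlaneSections

open MvPolynomial

/-- The sections `x, y, z, 0` of `O(1)` on the plane. -/
noncomputable def planeLinear : Fin 4 → MvPolynomial (Fin 3) ℂ := ![X 0, X 1, X 2, 0]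

/-- The sections `y ^ m, 0, x ^ m, z ^ m` of `O(m)` on the plane. -/
noncomputable def planePower (m : ℕ) : Fin 4 → MvPolynomial (Fin 3) ℂ :=
  ![X 1 ^ m, 0, X 0 ^ m, X 2 ^ m]

theorem isHomogeneous_planeLinear (i : Fin 4) : (planeLinear i).IsHomogeneous 1 := by
  fin_cases i
  exacts [isHomogeneous_X _ _, isHomogeneous_X _ _, isHomogeneous_X _ _, isHomogeneous_zero _ _ _]

theorem isHomogeneous_planePower (m : ℕ) (i : Fin 4) : (planePower m i).IsHomogeneous m := by
  fin_cases i
  exacts [isHomogeneous_X_pow _ _, isHomogeneous_zero _ _ _, isHomogeneous_X_pow _ _,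
    isHomogeneous_X_pow _ _]

/-- The equations come from the minors `01`, `02`, `12`, and then `03`, `13`, `23` together; the
sign of the minor `01` cancels. -/
theorem forall_minor_iff (m : ℕ) (v w : Fin 3 → ℂ) (c : ℂ) :
    (∀ p, c * eval w (minor planeLinear (planePower m) p) =
      eval v (minor planeLinear (planePower m) p)) ↔
    c * (w 1 * w 1 ^ m) = v 1 * v 1 ^ m ∧
    c * (w 0 * w 0 ^ m - w 2 * w 1 ^ m) = v 0 * v 0 ^ m - v 2 * v 1 ^ m ∧
    c * (w 1 * w 0 ^ m) = v 1 * v 0 ^ m ∧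
    ∀ i, c * (w i * w 2 ^ m) = v i * v 2 ^ m := by
  simp only [Subtype.forall, Prod.forall, Fin.forall_fin_succ, minor, planeLinear, planePower]
  simp
  tauto

theorem minor_planeSections_ne_zero (m : ℕ) (v : Fin 3 → ℂ) (hv : v ≠ 0) :
    (fun p => eval v (minor planeLinear (planePower m) p)) ≠ 0 := by
  intro h
  -- The factor `c = 0` turns proportionality into vanishing of all minors at `v`.
  obtain ⟨h01, h02, -, h2⟩ := (forall_minor_iff m v v 0).1 fun p => by
    rw [zero_mul]; exact (congrFun h p).symm
  simp only [zero_mul, zero_eq_mul, pow_eq_zero_iff'] at h01 h02 h2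
  have hv1 : v 1 = 0 := by tauto
  have hv2 : v 2 = 0 := by
    have := h2 2
    tauto
  rw [hv2, zero_mul, sub_zero, zero_eq_mul, pow_eq_zero_iff'] at h02
  have hv0 : v 0 = 0 := by tauto
  refine hv (funext fun i => ?_)
  fin_cases i <;> assumption

theorem exists_smul_eq_of_minor_planeSections {m : ℕ} {v w : Fin 3 → ℂ} (hv : v ≠ 0) (hw : w ≠ 0)
    {c : ℂ} (h : ∀ p, c * eval w (minor planeLinear (planePower m) p) =
      eval v (minor planeLinear (planePower m) p)) : ∃ a : ℂ, a • w = v := by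
  have hc : c ≠ 0 := by
    rintro rfl
    exact minor_planeSections_ne_zero m v hv (funext fun p => by simpa using (h p).symm)
  obtain ⟨h01, h02, h12, h3⟩ := (forall_minor_iff m v w c).1 h
  -- Testing the power rather than the coordinate covers `m = 0`, where it equals `1` and the second
  -- case always applies.
  by_cases hz : v 2 ^ m = 0
  · have hv2 : v 2 = 0 := (pow_eq_zero_iff'.1 hz).1
    have hw2 : w 2 = 0 := by
      have := h3 2
      rw [hz, mul_zero] at this
      simp only [mul_eq_zero, hc, false_or, pow_eq_zero_iff'] at this
      tauto
    rw [hv2, hw2, zero_mul, zero_mul, sub_zero, sub_zero] at h02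
    by_cases hv0 : v 0 = 0
    · have hw0 : w 0 = 0 := by
        rw [hv0, zero_mul] at h02
        simp only [mul_eq_zero, hc, false_or, pow_eq_zero_iff'] at h02
        tauto
      -- Both points are `(0 : 1 : 0)`.
      have hw1 : w 1 ≠ 0 := fun h1 => hw (funext fun i => by fin_cases i <;> assumption)
      refine ⟨v 1 / w 1, funext fun i => ?_⟩
      fin_cases i
      · simp [hw0, hv0]
      · simp [hw1]
      · simp [hw2, hv2]
    · have hpow : v 0 ^ m ≠ 0 := pow_ne_zero _ hv0
      -- On `z = 0` the minors `02` and `12` are `x^m (x, y)`, which dictates this ratio.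
      refine ⟨c * w 0 ^ m / v 0 ^ m, funext fun i => ?_⟩
      simp only [Pi.smul_apply, smul_eq_mul, div_mul_eq_mul_div]
      rw [div_eq_iff hpow]
      fin_cases i
      · rw [mul_assoc, mul_comm (w 0 ^ m)]
        exact h02
      · rw [mul_assoc, mul_comm (w 0 ^ m)]
        exact h12
      · simp [hw2, hv2]
  -- Here the minors `03`, `13`, `23` are `z^m (x, y, z)`.
  · refine ⟨c * w 2 ^ m / v 2 ^ m, funext fun i => ?_⟩
    simp only [Pi.smul_apply, smul_eq_mul, div_mul_eq_mul_div]
    rw [div_eq_iff hz, ← h3 i]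
    ring

theorem grassmannianMap_planeSections_injective (m : ℕ) :
    Function.Injective
      (grassmannianMap planeLinear (planePower m) (minor_planeSections_ne_zero m)) := by
  intro x y hxy
  obtain ⟨c, hc⟩ := exists_minor_eq_of_grassmannianMap_eq _ _ _ hxy
  obtain ⟨a, ha⟩ := exists_smul_eq_of_minor_planeSections x.rep_nonzero y.rep_nonzero hc
  rw [← x.mk_rep, ← y.mk_rep]
  exact (Projectivization.mk_eq_mk_iff' ℂ _ _ _ _).2 ⟨a, ha⟩

end PlaneSections

end GrassmannianVariety

open GrassmannianVariety ProjectiveVariety in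
theorem mainTheorem3 (n : ℕ) (hn : 1 ≤ n) :
    ∃ (s : Fin 4 → (ProjectiveVariety.twist (Fin 3) 1).GlobalSection)
      (t : Fin 4 → (ProjectiveVariety.twist (Fin 3) (n - 1)).GlobalSection)
      (f : SpaceWithFunctions.Hom projectivePlane GrassmannianVariety.grassmannian),
      (∀ x, Function.Surjective (SpaceWithFunctions.evalMap _ _ s t x)) ∧
      (∀ x, Module.Grassmannian.toSubmodule (f.map x) =
        LinearMap.ker (SpaceWithFunctions.evalMap _ _ s t x)) ∧
      Function.Injective f.map ∧
      Nonempty (SpaceWithFunctions.LineBundle.Iso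
        (GrassmannianVariety.grassmannianTwist.pullback f)
        (ProjectiveVariety.twist (Fin 3) n)) := by
  -- Writing `n` as `1 + m` makes it literally the degree `a + b` of the minors.
  obtain ⟨m, rfl⟩ := Nat.exists_eq_add_of_le hn
  rw [Nat.add_sub_cancel_left]
  have hl := isHomogeneous_planeLinear
  have hq := isHomogeneous_planePower m
  have hne := minor_planeSections_ne_zero m
  exact ⟨fun i => homogeneousSection (hl i), fun i => homogeneousSection (hq i),
    grassmannianHom _ _ hne hl hq, evalMap_surjective _ _ hne hl hq,
    toSubmodule_grassmannianMap _ _ hne hl hq, grassmannianMap_planeSections_injective m,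
    ⟨grassmannianTwistPullbackIso _ _ hne hl hq⟩⟩
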